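/- Let $B=[a,b]$ be a segment of the real line ($a\le b$), let $x_1,\dots,x_n\in\mathbb R$ ($n\ge 1$, in arbitrary order) be the positions of $n$ sensors with common covering range $z\ge 0$, so that a sensor at position $y$ covers $[y-z,y+z]$, and suppose $b-a\le 2zn$. The min-sum barrier coverage problem (MSBC) asks for new positions $y_1,\dots,y_n$ such that every point of $B$ lies in $[y_i-z,y_i+z]$ for some $i$ and $\sum_{i=1}^n|y_i-x_i|$ is minimum among all such choices. Then the containing case of MSBC is solvable in $O(n\log n)$ time on the real RAM: there are one program for the real RAM (unit-cost arithmetic $+,-,\times,/$ and comparisons on real numbers, unit-cost addition, subtraction, halving and comparison of the natural numbers that serve as counters and addresses, unit-cost indirect addressing, no floor function) and a constant $C$ such that, for every input $(n,a,b,z,x_1,\dots,x_n)$ as above in which every covering interval $[x_i-z,x_i+z]$ intersects $B$, the program halts after at most $C\,n\log(n+1)$ time steps and outputs an optimal solution $y_1,\dots,y_n$. -/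

import Mathlib

namespace MSBC

/-! ### The min-sum barrier coverage problem -/

/-- Sensors at positions `y`, each covering `[y i - z, y i + z]`, cover the barrier `[a, b]`. -/
def Covers {n : ℕ} (a b z : ℝ) (y : Fin n → ℝ) : Prop :=
  ∀ p ∈ Set.Icc a b, ∃ i, p ∈ Set.Icc (y i - z) (y i + z)

/-- The containing case: every sensor's covering interval intersects the barrier. -/
def Containing {n : ℕ} (a b z : ℝ) (x : Fin n → ℝ) : Prop :=
  ∀ i, (Set.Icc (x i - z) (x i + z) ∩ Set.Icc a b).Nonempty

/-- The sum of the moving distances when sensor `i` moves from `x i` to `y i`. -/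
def moveCost {n : ℕ} (x y : Fin n → ℝ) : ℝ :=
  ∑ i, |y i - x i|

/-- `y` is an optimal solution for the sensors at `x`. -/
def IsOptimal {n : ℕ} (a b z : ℝ) (x y : Fin n → ℝ) : Prop :=
  Covers a b z y ∧ ∀ y' : Fin n → ℝ, Covers a b z y' → moveCost x y ≤ moveCost x y'

/-! ### The real RAM

A random access machine whose memory consists of arrays of natural numbers, used for counting and
for indirect addressing, and arrays of real numbers. The arrays are numbered, and the number of an
array is fixed in the program text, so that a program uses finitely many of them. Every arithmetic
operation, comparison, memory access and assignment costs one unit of time. There is no conversion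
between real and natural numbers (no floor function), and naturals cannot be multiplied. -/

/-- `nat r i` and `real r i` are the contents of cell `i` of the `r`-th array of that kind. -/
structure State where
  nat : ℕ → ℕ → ℕ
  real : ℕ → ℕ → ℝ

/-- Overwrite cell `i` of the natural-number array `r`. -/
def State.setNat (s : State) (r i v : ℕ) : State :=
  { s with nat := Function.update s.nat r (Function.update (s.nat r) i v) }

/-- Overwrite cell `i` of the real array `r`. -/
def State.setReal (s : State) (r i : ℕ) (v : ℝ) : State :=
  { s with real := Function.update s.real r (Function.update (s.real r) i v) }

/-- Expressions with natural-number value. -/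
inductive NExp where
  | const (c : ℕ)
  | cell (r : ℕ) (i : NExp)
  | add (e f : NExp)
  | sub (e f : NExp)
  | half (e : NExp)

/-- Subtraction is truncated at zero and halving rounds down. -/
def NExp.eval (s : State) : NExp → ℕ
  | .const c => c
  | .cell r i => s.nat r (i.eval s)
  | .add e f => e.eval s + f.eval s
  | .sub e f => e.eval s - f.eval s
  | .half e => e.eval s / 2

/-- The time to evaluate an expression: one unit for every node. -/
def NExp.time : NExp → ℕ
  | .const _ => 1
  | .cell _ i => i.time + 1
  | .add e f => e.time + f.time + 1
  | .sub e f => e.time + f.time + 1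
  | .half e => e.time + 1

/-- Expressions with real value. The constants in a program are integers. -/
inductive RExp where
  | const (c : ℤ)
  | cell (r : ℕ) (i : NExp)
  | add (e f : RExp)
  | sub (e f : RExp)
  | mul (e f : RExp)
  | div (e f : RExp)

/-- A division by zero yields zero. -/
noncomputable def RExp.eval (s : State) : RExp → ℝ
  | .const c => (c : ℝ)
  | .cell r i => s.real r (i.eval s)
  | .add e f => e.eval s + f.eval s
  | .sub e f => e.eval s - f.eval s
  | .mul e f => e.eval s * f.eval s
  | .div e f => e.eval s / f.eval s

def RExp.time : RExp → ℕ
  | .const _ => 1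
  | .cell _ i => i.time + 1
  | .add e f => e.time + f.time + 1
  | .sub e f => e.time + f.time + 1
  | .mul e f => e.time + f.time + 1
  | .div e f => e.time + f.time + 1

/-- Tests. -/
inductive BExp where
  | natLe (e f : NExp)
  | realLe (e f : RExp)
  | not (b : BExp)
  | and (b c : BExp)

def BExp.Holds (s : State) : BExp → Prop
  | .natLe e f => e.eval s ≤ f.eval s
  | .realLe e f => e.eval s ≤ f.eval s
  | .not b => ¬ b.Holds s
  | .and b c => b.Holds s ∧ c.Holds s

def BExp.time : BExp → ℕ
  | .natLe e f => e.time + f.time + 1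
  | .realLe e f => e.time + f.time + 1
  | .not b => b.time + 1
  | .and b c => b.time + c.time + 1

/-- Programs. `loop b P` is the while-loop "while `b` do `P`". -/
inductive Program where
  | skip
  | natSet (r : ℕ) (i e : NExp)
  | realSet (r : ℕ) (i : NExp) (e : RExp)
  | seq (P Q : Program)
  | branch (b : BExp) (P Q : Program)
  | loop (b : BExp) (P : Program)

/-- `Exec P s s' t`: started in state `s`, the program `P` halts in state `s'` after `t` units
of time. -/
inductive Exec : Program → State → State → ℕ → Prop where
  | skip (s : State) : Exec .skip s s 1
  | natSet (r : ℕ) (i e : NExp) (s : State) :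
      Exec (.natSet r i e) s (s.setNat r (i.eval s) (e.eval s)) (i.time + e.time + 1)
  | realSet (r : ℕ) (i : NExp) (e : RExp) (s : State) :
      Exec (.realSet r i e) s (s.setReal r (i.eval s) (e.eval s)) (i.time + e.time + 1)
  | seq {P Q : Program} {s s' s'' : State} {t t' : ℕ} :
      Exec P s s' t → Exec Q s' s'' t' → Exec (.seq P Q) s s'' (t + t')
  | branch_true {b : BExp} {P Q : Program} {s s' : State} {t : ℕ} :
      b.Holds s → Exec P s s' t → Exec (.branch b P Q) s s' (b.time + 1 + t)
  | branch_false {b : BExp} {P Q : Program} {s s' : State} {t : ℕ} :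
      ¬ b.Holds s → Exec Q s s' t → Exec (.branch b P Q) s s' (b.time + 1 + t)
  | loop_true {b : BExp} {P : Program} {s s' s'' : State} {t t' : ℕ} :
      b.Holds s → Exec P s s' t → Exec (.loop b P) s' s'' t' →
        Exec (.loop b P) s s'' (b.time + 1 + t + t')
  | loop_false {b : BExp} {P : Program} {s : State} :
      ¬ b.Holds s → Exec (.loop b P) s s (b.time + 1)

/-- The machine is deterministic: final state and running time are determined by the program and
the initial state. -/
theorem Exec.deterministic {P : Program} {s s₁ s₂ : State} {t₁ t₂ : ℕ}
    (h₁ : Exec P s s₁ t₁) (h₂ : Exec P s s₂ t₂) : s₁ = s₂ ∧ t₁ = t₂ := by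
  induction h₁ generalizing s₂ t₂ with
  | skip s => cases h₂; exact ⟨rfl, rfl⟩
  | natSet r i e s => cases h₂; exact ⟨rfl, rfl⟩
  | realSet r i e s => cases h₂; exact ⟨rfl, rfl⟩
  | seq _ _ ih ih' =>
    cases h₂ with
    | seq k k' =>
      obtain ⟨rfl, rfl⟩ := ih k
      obtain ⟨rfl, rfl⟩ := ih' k'
      exact ⟨rfl, rfl⟩
  | branch_true hb _ ih =>
    cases h₂ with
    | branch_true _ k =>
      obtain ⟨rfl, rfl⟩ := ih k
      exact ⟨rfl, rfl⟩
    | branch_false hb' _ => exact absurd hb hb'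
  | branch_false hb _ ih =>
    cases h₂ with
    | branch_true hb' _ => exact absurd hb' hb
    | branch_false _ k =>
      obtain ⟨rfl, rfl⟩ := ih k
      exact ⟨rfl, rfl⟩
  | loop_true hb _ _ ih ih' =>
    cases h₂ with
    | loop_true _ k k' =>
      obtain ⟨rfl, rfl⟩ := ih k
      obtain ⟨rfl, rfl⟩ := ih' k'
      exact ⟨rfl, rfl⟩
    | loop_false hb' => exact absurd hb hb'
  | loop_false hb =>
    cases h₂ with
    | loop_true hb' _ _ => exact absurd hb' hb
    | loop_false _ => exact ⟨rfl, rfl⟩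

/-- The initial state: cell `0` of natural-number array `0` holds `n`; cells `0, 1, 2` of real array
`0` hold `a, b, z`; cells `0, …, n - 1` of real array `1` hold the sensor positions, in the order in
which they are given; all other cells are zero. -/
noncomputable def inputState {n : ℕ} (a b z : ℝ) (x : Fin n → ℝ) : State where
  nat r i := if r = 0 ∧ i = 0 then n else 0
  real r i :=
    if r = 0 then (if i = 0 then a else if i = 1 then b else if i = 2 then z else 0)
    else if r = 1 then (if h : i < n then x ⟨i, h⟩ else 0)
    else 0

/-- The output: the `i`-th sensor is sent to the position in cell `i` of real array `2`. -/
def State.output (s : State) (n : ℕ) : Fin n → ℝ :=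
  fun i => s.real 2 i

end MSBC

/-! Sort the sensors from right to left. Uncrossing two sensors never raises the cost
(`exists_antitone_moveCost_le`), and in the containing case projecting all positions onto `[a - z, b
+ z]` does not either (`exists_clamp`). For positions normalized in this way, covering the barrier
forces a chain of inequalities: the first position is at least `b - z`, the last is at most `a + z`,
and consecutive positions drop by at most `2 * z` (`chain_of_covers`). Conversely, any such chain
covers (`covers_of_chain`).

Adding the offset `2 * z * j` to the `j`-th position turns the chain into a nondecreasing sequence
with values between `b - z` and `a - z + 2 * z * n`. The problem is then isotonic regression in the
`ℓ¹` norm with bounds. Targets below `b - z` may be raised to `b - z`, which changes every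
admissible cost by the same constant.

As a function of the upper bound `t`, the least cost of a prefix is a constant plus a sum of hinges
`max (κ l - t) 0`. A new target `w` inserts `w` twice among the breakpoints and deletes the largest
one, and this deleted maximum is the unconstrained best last value (`RegressionInv.step`). Running
minima of the deleted maxima, taken backwards, recover an optimal sequence
(`isOptimal_of_regression`).

Sorting and regression both need only "find the largest key" and "replace a key". A tournament tree
finds the largest key in constant time and replaces a key by replaying one path from leaf to root
(`climb_runs`). With `O(n)` replacements, linear construction and linear placement, the total is
`O(n log n)`. -/

namespace MSBC

section Optimization

open Finset

/-! ### Isotonic regression in the `ℓ¹` norm -/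

/-- The convex piecewise linear function with breakpoints `κ 0, …, κ (n - 1)`. -/
noncomputable def hinge (n : ℕ) (κ : ℕ → ℝ) (t : ℝ) : ℝ :=
  ∑ l ∈ range n, max (κ l - t) 0

theorem hinge_antitone (n : ℕ) (κ : ℕ → ℝ) : Antitone (hinge n κ) := fun _ _ h =>
  sum_le_sum fun _ _ => max_le_max (by linarith) le_rfl

theorem hinge_eq_zero {n : ℕ} {κ : ℕ → ℝ} {t : ℝ} (h : ∀ l < n, κ l ≤ t) : hinge n κ t = 0 :=
  sum_eq_zero fun l hl => max_eq_right (by linarith [h l (mem_range.1 hl)])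

theorem hinge_update {n j : ℕ} (hj : j < n) (κ : ℕ → ℝ) (p t : ℝ) :
    hinge n (Function.update κ j p) t + max (κ j - t) 0 = hinge n κ t + max (p - t) 0 := by
  unfold hinge
  rw [← add_sum_erase _ _ (mem_range.2 hj), ← add_sum_erase (range n) _ (mem_range.2 hj)]
  have : ∀ l ∈ (range n).erase j, max (Function.update κ j p l - t) 0 = max (κ l - t) 0 := by
    intro l hl
    rw [Function.update_of_ne (ne_of_mem_erase hl)]
  rw [sum_congr rfl this, Function.update_self]
  ring

/-- After `j` values of `w` have been processed, with breakpoints `κ` and recorded maxima `m`, the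
least cost of a nondecreasing sequence in `[d, t]` is `hinge n κ t` up to a constant, and it is
attained by the running minimum of `m` taken backwards from `t`. -/
structure RegressionInv (n : ℕ) (d : ℝ) (w m : ℕ → ℝ) (j : ℕ) (κ : ℕ → ℝ) : Prop where
  fresh : ∀ l, j ≤ l → l < n → κ l < d
  le_max : ∀ i < j, d ≤ m i
  value : ∃ C : ℝ,
    (∀ v : ℕ → ℝ, MonotoneOn v (Set.Iio j) → (∀ i < j, d ≤ v i) → ∀ t, d ≤ t →
      (∀ i < j, v i ≤ t) → C + hinge n κ t ≤ ∑ i ∈ range j, |v i - w i|) ∧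
    ∀ (u : ℕ → ℝ), d ≤ u j → (∀ i < j, u i = min (m i) (u (i + 1))) →
      ∑ i ∈ range j, |u i - w i| = C + hinge n κ (u j)

theorem RegressionInv.init {n : ℕ} {d : ℝ} {w m κ : ℕ → ℝ} (h : ∀ l < n, κ l < d) :
    RegressionInv n d w m 0 κ where
  fresh l _ hl := h l hl
  le_max i hi := absurd hi (Nat.not_lt_zero i)
  value := ⟨0, fun v _ _ t ht _ => by
      simp [hinge_eq_zero fun l hl => (h l hl).le.trans ht], fun u hu _ => by
      simp [hinge_eq_zero fun l hl => (h l hl).le.trans hu]⟩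

/-- Adding the breakpoint `p` twice and removing the largest breakpoint. -/
theorem hinge_replace_max {n j l₀ : ℕ} {κ : ℕ → ℝ} {d p s : ℝ} (hj : j < n) (hl : l₀ < n)
    (hκ : κ j ≤ d) (hs : d ≤ s) :
    hinge n κ s + |s - p| = hinge n (Function.update (Function.update κ j p) l₀ p) s +
      max (Function.update κ j p l₀ - s) 0 + (s - p) := by
  have h1 := hinge_update hj κ p s
  have h2 := hinge_update hl (Function.update κ j p) p s
  rw [max_eq_right (by linarith : κ j - s ≤ 0)] at h1
  have h3 : |s - p| = 2 * max (p - s) 0 + (s - p) := by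
    rcases le_total p s with h | h
    · rw [abs_of_nonneg (by linarith), max_eq_right (by linarith)]; ring
    · rw [abs_of_nonpos (by linarith), max_eq_left (by linarith)]; ring
  linarith

/-- Let `M = m' j` be the largest breakpoint after the insertion of `w j`. By `hinge_replace_max`,
the old value plus `|s - w j|` is the new hinge sum plus `max (M - s) 0 + (s - w j)`. The last part
is the constant `M - w j` for `s ≤ M` and grows with slope one beyond, where the new hinge sum
vanishes. Minimizing over `s ≤ t` therefore gives the new hinge sum at `t` plus `M - w j`, attained
at `s = min M t`. -/
theorem RegressionInv.step {n j l₀ : ℕ} {d : ℝ} {w m m' κ : ℕ → ℝ}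
    (h : RegressionInv n d w m j κ) (hj : j < n) (hl : l₀ < n) (hw : d ≤ w j)
    (hmax : ∀ l < n, Function.update κ j (w j) l ≤ Function.update κ j (w j) l₀)
    (hm : ∀ i < j, m' i = m i) (hmj : m' j = Function.update κ j (w j) l₀) :
    RegressionInv n d w m' (j + 1)
      (Function.update (Function.update κ j (w j)) l₀ (w j)) := by
  have hwM : w j ≤ m' j := by
    have := hmax j hj
    rwa [Function.update_self, ← hmj] at this
  have hκ : ∀ l < n, Function.update (Function.update κ j (w j)) l₀ (w j) l ≤ m' j := by
    intro l hln
    rcases eq_or_ne l l₀ with rfl | hne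
    · rwa [Function.update_self]
    · rw [Function.update_of_ne hne, hmj]
      exact hmax l hln
  have hrep : ∀ s, d ≤ s → hinge n κ s + |s - w j| =
      hinge n (Function.update (Function.update κ j (w j)) l₀ (w j)) s +
        max (m' j - s) 0 + (s - w j) := by
    intro s hs
    rw [hmj]
    exact hinge_replace_max hj hl (h.fresh j le_rfl hj).le hs
  refine ⟨?_, ?_, ?_⟩
  · intro l hjl hln
    have hne : l ≠ j := by omega
    have hκl : κ l < d := h.fresh l (by omega) hln
    -- An unused slot holds a value below `d`, while the maximum is at least `w j ≥ d`.
    have hne' : l ≠ l₀ := by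
      rintro rfl
      rw [Function.update_of_ne hne] at hmj
      linarith
    rwa [Function.update_of_ne hne', Function.update_of_ne hne]
  · intro i hi
    rcases Nat.lt_succ_iff_lt_or_eq.1 hi with hi | rfl
    · rw [hm i hi]
      exact h.le_max i hi
    · linarith
  · obtain ⟨C, hlow, hatt⟩ := h.value
    refine ⟨C + m' j - w j, ?_, ?_⟩
    · intro v hv hd t ht hvt
      have hvj : d ≤ v j := hd j (Nat.lt_succ_self j)
      have h1 := hlow v (hv.mono (Set.Iio_subset_Iio (Nat.le_succ j)))
        (fun i hi => hd i (hi.trans (Nat.lt_succ_self j))) (v j) hvj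
        (fun i hi => hv (Set.mem_Iio.2 (hi.trans (Nat.lt_succ_self j)))
          (Set.mem_Iio.2 (Nat.lt_succ_self j)) hi.le)
      have h2 := hrep (v j) hvj
      have h3 := hinge_antitone n (Function.update (Function.update κ j (w j)) l₀ (w j))
        (hvt j (Nat.lt_succ_self j))
      rw [sum_range_succ]
      linarith [le_max_left (m' j - v j) 0]
    · intro u hu hrec
      have huj := hrec j (Nat.lt_succ_self j)
      have hdj : d ≤ u j := by
        rw [huj]
        exact le_min (hw.trans hwM) hu
      have h1 := hatt u hdj fun i hi => by
        rw [hrec i (hi.trans (Nat.lt_succ_self j)), hm i hi]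
      have h2 := hrep (u j) hdj
      rw [sum_range_succ, h1]
      rcases le_total (m' j) (u (j + 1)) with hle | hle
      · rw [min_eq_left hle] at huj
        rw [hinge_eq_zero fun l hl => (hκ l hl).trans hle]
        have h3 := hinge_eq_zero fun l hl => (hκ l hl).trans_eq huj.symm
        rw [max_eq_right (by linarith)] at h2
        linarith
      · rw [min_eq_right hle] at huj
        rw [← huj]
        rw [max_eq_left (by linarith)] at h2
        linarith

/-! ### Reduction of barrier coverage to isotonic regression -/

theorem abs_sub_swap_le {p q r s : ℝ} (h : p ≤ q) (h' : r ≤ s) :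
    |r - p| + |s - q| ≤ |s - p| + |r - q| := by
  rcases abs_cases (r - p) with h1 | h1 <;> rcases abs_cases (s - q) with h2 | h2 <;>
    rcases abs_cases (s - p) with h3 | h3 <;> rcases abs_cases (r - q) with h4 | h4 <;> linarith

theorem moveCost_comp_swap_le {n : ℕ} {x y : Fin n → ℝ} (hx : Monotone x) {i j : Fin n}
    (hij : i < j) (hy : y j ≤ y i) : moveCost x (y ∘ Equiv.swap i j) ≤ moveCost x y := by
  unfold moveCost
  have hj : j ∈ univ.erase i := by simp [hij.ne']
  rw [← add_sum_erase _ _ (mem_univ i), ← add_sum_erase _ _ hj,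
    ← add_sum_erase univ (fun k => |y k - x k|) (mem_univ i), ← add_sum_erase _ _ hj]
  have : ∀ k ∈ (univ.erase i).erase j, |(y ∘ Equiv.swap i j) k - x k| = |y k - x k| := by
    intro k hk
    simp only [mem_erase] at hk
    rw [Function.comp_apply, Equiv.swap_apply_of_ne_of_ne hk.2.1 hk.1]
  rw [sum_congr rfl this]
  simp only [Function.comp_apply, Equiv.swap_apply_left, Equiv.swap_apply_right]
  linarith [abs_sub_swap_le (hx hij.le) hy]

/-- Bubble sort removes one inversion at a time, and each such swap is an uncrossing. -/
theorem moveCost_comp_sort_le {n : ℕ} {x : Fin n → ℝ} (hx : Monotone x) (y : Fin n → ℝ) :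
    moveCost x (y ∘ Tuple.sort y) ≤ moveCost x y := by
  refine Tuple.bubble_sort_induction' (f := y) (P := fun g => moveCost x g ≤ moveCost x y) le_rfl ?_
  intro σ i j hij hlt h
  exact (moveCost_comp_swap_le (y := y ∘ σ) hx hij hlt.le).trans h

/-- Moving sensors without letting them cross is never more expensive. -/
theorem exists_antitone_moveCost_le {n : ℕ} {x : Fin n → ℝ} (hx : Antitone x) (y : Fin n → ℝ) :
    ∃ τ : Equiv.Perm (Fin n), Antitone (y ∘ τ) ∧ moveCost x (y ∘ τ) ≤ moveCost x y := by
  have hneg : ∀ u v : Fin n → ℝ, moveCost (-u) (-v) = moveCost u v := by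
    intro u v
    refine sum_congr rfl fun i _ => ?_
    rw [Pi.neg_apply, Pi.neg_apply, ← abs_neg]
    ring_nf
  refine ⟨Tuple.sort (-y), fun i j hij => ?_, ?_⟩
  · have := Tuple.monotone_sort (-y) hij
    simpa using this
  · have := moveCost_comp_sort_le hx.neg (-y)
    rwa [show (fun i => -x i) = -x from rfl, hneg,
      show (-y) ∘ Tuple.sort (-y) = -(y ∘ Tuple.sort (-y)) from rfl, hneg] at this

/-- Sensors listed from right to left without gaps cover the barrier. -/
theorem covers_of_chain {n : ℕ} {a b z : ℝ} {y : Fin n → ℝ} (Y : ℕ → ℝ) (hn : 1 ≤ n)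
    (hY : ∀ j < n, ∃ i, y i = Y j) (h0 : b - z ≤ Y 0)
    (hstep : ∀ j, j + 1 < n → Y j - 2 * z ≤ Y (j + 1)) (hlast : Y (n - 1) ≤ a + z) :
    Covers a b z y := by
  intro p hp
  obtain ⟨hap, hpb⟩ := hp
  suffices ∃ j < n, p ∈ Set.Icc (Y j - z) (Y j + z) by
    obtain ⟨j, hj, hpj⟩ := this
    obtain ⟨i, hi⟩ := hY j hj
    exact ⟨i, by rwa [hi]⟩
  by_contra! hne
  have key : ∀ j < n, p < Y j - z := by
    intro j
    induction j with
    | zero =>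
      intro hj
      by_contra! hlt
      exact hne 0 hj ⟨hlt, by linarith⟩
    | succ j ih =>
      intro hj
      by_contra! hlt
      have h1 := ih (by omega)
      have h2 := hstep j hj
      exact hne (j + 1) hj ⟨hlt, by linarith⟩
  have := key (n - 1) (by omega)
  linarith

/-- In the containing case every `x i` lies in `[a - z, b + z]`, so projecting `y i` onto that
interval brings it no farther from `x i`. The projected sensor still covers every barrier point it
covered before. -/
theorem exists_clamp {n : ℕ} {a b z : ℝ} {x y : Fin n → ℝ} (hz : 0 ≤ z) (hab : a ≤ b)
    (hx : Containing a b z x) (hy : Covers a b z y) :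
    ∃ y' : Fin n → ℝ, Covers a b z y' ∧ (∀ i, y' i ∈ Set.Icc (a - z) (b + z)) ∧
      moveCost x y' ≤ moveCost x y := by
  refine ⟨fun i => max (a - z) (min (b + z) (y i)), ?_, ?_, ?_⟩
  · intro p hp
    obtain ⟨i, hi⟩ := hy p hp
    refine ⟨i, ?_⟩
    simp only [Set.mem_Icc] at *
    constructor
    · rw [sub_le_iff_le_add]
      exact max_le (by linarith) ((min_le_right _ _).trans (by linarith))
    · rw [← sub_le_iff_le_add]
      exact le_max_of_le_right (le_min (by linarith) (by linarith))
  · intro i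
    exact ⟨le_max_left _ _, max_le (by linarith) (min_le_left _ _)⟩
  · refine sum_le_sum fun i _ => ?_
    obtain ⟨q, hq, hq'⟩ := hx i
    simp only [Set.mem_Icc] at hq hq'
    rcases max_cases (a - z) (min (b + z) (y i)) with h | h <;>
      rcases min_cases (b + z) (y i) with h' | h' <;>
      rcases abs_cases (y i - x i) with h1 | h1 <;>
      rcases abs_cases (max (a - z) (min (b + z) (y i)) - x i) with h2 | h2 <;> linarith

/-- If two neighbours were more than `2 * z` apart, their midpoint would be uncovered. The bounds
`hmem` ensure that this midpoint lies on the barrier, so a gap outside the barrier cannot occur. -/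
theorem chain_of_covers {n : ℕ} {a b z : ℝ} {y : Fin n → ℝ} (hab : a ≤ b)
    (hy : Covers a b z y) (hmem : ∀ i, y i ∈ Set.Icc (a - z) (b + z)) (hanti : Antitone y)
    (hn : 0 < n) :
    b - z ≤ y ⟨0, hn⟩ ∧ y ⟨n - 1, by omega⟩ ≤ a + z ∧
      ∀ j (hj : j + 1 < n), y ⟨j, by omega⟩ - 2 * z ≤ y ⟨j + 1, hj⟩ := by
  refine ⟨?_, ?_, ?_⟩
  · obtain ⟨i, hi⟩ := hy b ⟨hab, le_rfl⟩
    have : y i ≤ y ⟨0, hn⟩ := hanti (Fin.mk_le_mk.2 (Nat.zero_le _))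
    linarith [hi.2]
  · obtain ⟨i, hi⟩ := hy a ⟨le_rfl, hab⟩
    have : y ⟨n - 1, by omega⟩ ≤ y i := hanti (Fin.mk_le_mk.2 (by omega))
    linarith [hi.1]
  · intro j hj
    by_contra! hlt
    have h1 := (hmem ⟨j, by omega⟩).2
    have h2 := (hmem ⟨j + 1, hj⟩).1
    obtain ⟨i, hi⟩ := hy ((y ⟨j, by omega⟩ + y ⟨j + 1, hj⟩) / 2)
      ⟨by linarith, by linarith⟩
    rcases Nat.lt_or_ge j i with hji | hji
    · have : y i ≤ y ⟨j + 1, hj⟩ := hanti (Fin.mk_le_mk.2 hji)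
      linarith [hi.2]
    · have : y ⟨j, by omega⟩ ≤ y i := hanti (Fin.mk_le_mk.2 hji)
      linarith [hi.1]

theorem moveCost_comp_perm {n : ℕ} (x y : Fin n → ℝ) (σ : Equiv.Perm (Fin n)) :
    moveCost (x ∘ σ) (y ∘ σ) = moveCost x y :=
  Equiv.sum_comp σ fun i => |y i - x i|

/-- The running minima of a finished regression give an optimal solution. -/
theorem isOptimal_of_regression {n : ℕ} {a b z : ℝ} {x y : Fin n → ℝ} (hn : 1 ≤ n) (hz : 0 ≤ z)
    (hab : a ≤ b) (hlen : b - a ≤ 2 * z * n) (hx : Containing a b z x)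
    (σ : Equiv.Perm (Fin n)) (hσ : Antitone (x ∘ σ)) {w m κ u : ℕ → ℝ}
    (hw : ∀ j : Fin n, w j = max (x (σ j) + 2 * z * (j : ℕ)) (b - z))
    (hreg : RegressionInv n (b - z) w m n κ) (hun : u n = a - z + 2 * z * n)
    (hu : ∀ i < n, u i = min (m i) (u (i + 1)))
    (hy : ∀ j : Fin n, y (σ j) = u j - 2 * z * (j : ℕ)) : IsOptimal a b z x y := by
  -- The bounds of the regression are compatible exactly because `b - a ≤ 2 * z * n`.
  have hdn : b - z ≤ u n := by rw [hun]; linarith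
  have hud : ∀ k, k ≤ n → b - z ≤ u (n - k) := by
    intro k
    induction k with
    | zero => exact fun _ => hdn
    | succ k ih =>
      intro hk
      rw [hu (n - (k + 1)) (by omega), show n - (k + 1) + 1 = n - k by omega]
      exact le_min (hreg.le_max _ (by omega)) (ih (by omega))
  have hud' : ∀ i ≤ n, b - z ≤ u i := fun i hi => by
    have := hud (n - i) (by omega)
    rwa [Nat.sub_sub_self hi] at this
  have husucc : ∀ i < n, u i ≤ u (i + 1) := fun i hi => by
    rw [hu i hi]
    exact min_le_right _ _
  constructor
  · refine covers_of_chain (fun j => u j - 2 * z * j) hn (fun j hj => ⟨σ ⟨j, hj⟩, hy ⟨j, hj⟩⟩)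
      ?_ ?_ ?_
    · simpa using hud' 0 (Nat.zero_le n)
    · intro j hj
      have := husucc j (by omega)
      push_cast
      linarith
    · have := husucc (n - 1) (by omega)
      rw [Nat.sub_add_cancel hn, hun] at this
      rw [Nat.cast_sub hn]
      push_cast
      linarith
  · intro y' hy'
    obtain ⟨y₁, hc, hmem, hle⟩ := exists_clamp hz hab hx hy'
    refine le_trans ?_ hle
    obtain ⟨τ, hτ, hle'⟩ := exists_antitone_moveCost_le hσ (y₁ ∘ σ)
    rw [moveCost_comp_perm] at hle'
    refine le_trans ?_ hle'
    rw [← moveCost_comp_perm x y σ]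
    have hc' : Covers a b z ((y₁ ∘ σ) ∘ τ) := by
      intro p hp
      obtain ⟨i, hi⟩ := hc p hp
      exact ⟨τ.symm (σ.symm i), by simpa using hi⟩
    obtain ⟨h0, hlast, hstep⟩ := chain_of_covers hab hc' (fun i => hmem _) hτ hn
    generalize (y₁ ∘ σ) ∘ τ = Y at *
    obtain ⟨C, hlow, hatt⟩ := hreg.value
    -- Past the last sensor the competitor is continued by the upper bound, which keeps it monotone
    -- on all of `ℕ`.
    set v : ℕ → ℝ := fun j => if h : j < n then Y ⟨j, h⟩ + 2 * z * j else u n with hv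
    have hvlt : ∀ j (h : j < n), v j = Y ⟨j, h⟩ + 2 * z * j := fun j h => by simp [hv, h]
    have hlast' : v (n - 1) ≤ u n := by
      rw [hvlt (n - 1) (by omega), hun, Nat.cast_sub hn]
      push_cast
      linarith
    have hvmono : Monotone v := by
      refine monotone_nat_of_le_succ fun j => ?_
      rcases Nat.lt_or_ge (j + 1) n with h | h
      · rw [hvlt j (by omega), hvlt (j + 1) h]
        have := hstep j h
        push_cast
        linarith
      · have h1 : v (j + 1) = u n := by simp [hv, Nat.not_lt.2 h]
        rw [h1]
        rcases Nat.lt_or_ge j n with h' | h'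
        · rwa [show j = n - 1 by omega]
        · simp [hv, Nat.not_lt.2 h']
    have hv0 : b - z ≤ v 0 := by
      rw [hvlt 0 hn]
      simpa using h0
    have hvd : ∀ i, b - z ≤ v i := fun i => hv0.trans (hvmono (Nat.zero_le i))
    have h1 := hlow v (hvmono.monotoneOn _) (fun i _ => hvd i) (u n) hdn
      (fun i hi => (hvmono (by omega)).trans hlast')
    rw [← hatt u hdn hu] at h1
    -- For values at least `b - z`, raising a lower target to `b - z` reduces the distance by
    -- exactly the amount raised, independently of `r`.
    have hcost : ∀ r : ℕ → ℝ, (∀ i < n, b - z ≤ r i) → ∀ Z : Fin n → ℝ,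
        (∀ j : Fin n, Z j = r j - 2 * z * (j : ℕ)) → moveCost (x ∘ σ) Z =
          ∑ i ∈ range n, |r i - w i| + ∑ j : Fin n, (w j - (x (σ j) + 2 * z * (j : ℕ))) := by
      intro r hr Z hZ
      rw [← Fin.sum_univ_eq_sum_range (fun i => |r i - w i|) n, ← sum_add_distrib]
      refine sum_congr rfl fun j _ => ?_
      have h2 := hr j j.2
      rw [hZ, Function.comp_apply, hw j]
      rcases max_cases (x (σ j) + 2 * z * (j : ℕ)) (b - z) with h | h
      · rw [h.1]
        ring_nf
      · rw [h.1, abs_of_nonneg (by linarith), abs_of_nonneg (by linarith)]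
        ring
    rw [hcost u (fun i hi => hud' i hi.le) (y ∘ σ) (fun j => hy j),
      hcost v (fun i _ => hvd i) Y (fun j => by rw [hvlt j j.2]; ring)]
    linarith

end Optimization

/-! ### Verification of programs -/

theorem State.setNat_nat (s : State) (r i v : ℕ) :
    (s.setNat r i v).nat r = Function.update (s.nat r) i v := by
  simp [State.setNat]

theorem State.setNat_nat_of_ne (s : State) {r r' : ℕ} (h : r' ≠ r) (i v : ℕ) :
    (s.setNat r i v).nat r' = s.nat r' := by
  simp [State.setNat, h]

theorem State.setNat_real (s : State) (r i v : ℕ) : (s.setNat r i v).real = s.real := rfl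

theorem State.setReal_real (s : State) (r i : ℕ) (v : ℝ) :
    (s.setReal r i v).real r = Function.update (s.real r) i v := by
  simp [State.setReal]

theorem State.setReal_real_of_ne (s : State) {r r' : ℕ} (h : r' ≠ r) (i : ℕ) (v : ℝ) :
    (s.setReal r i v).real r' = s.real r' := by
  simp [State.setReal, h]

theorem State.setReal_nat (s : State) (r i : ℕ) (v : ℝ) : (s.setReal r i v).nat = s.nat := rfl

attribute [simp] State.setNat_nat State.setNat_nat_of_ne State.setNat_real State.setReal_real
  State.setReal_real_of_ne State.setReal_nat NExp.eval RExp.eval BExp.Holds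

/-- Started in `s`, the program `P` halts within `T` units of time in a state satisfying `Q`. -/
def Runs (P : Program) (s : State) (T : ℕ) (Q : State → Prop) : Prop :=
  ∃ s' t, Exec P s s' t ∧ t ≤ T ∧ Q s'

theorem Runs.mono {P : Program} {s : State} {T T' : ℕ} {Q Q' : State → Prop}
    (h : Runs P s T Q) (hT : T ≤ T') (hQ : ∀ s', Q s' → Q' s') : Runs P s T' Q' := by
  obtain ⟨s', t, he, ht, hq⟩ := h
  exact ⟨s', t, he, ht.trans hT, hQ s' hq⟩

theorem Runs.skip {s : State} {Q : State → Prop} (h : Q s) : Runs .skip s 1 Q :=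
  ⟨s, 1, Exec.skip s, le_rfl, h⟩

theorem Runs.natSet {r : ℕ} {i e : NExp} {s : State} {Q : State → Prop}
    (h : Q (s.setNat r (i.eval s) (e.eval s))) :
    Runs (.natSet r i e) s (i.time + e.time + 1) Q :=
  ⟨_, _, Exec.natSet r i e s, le_rfl, h⟩

theorem Runs.realSet {r : ℕ} {i : NExp} {e : RExp} {s : State} {Q : State → Prop}
    (h : Q (s.setReal r (i.eval s) (e.eval s))) :
    Runs (.realSet r i e) s (i.time + e.time + 1) Q :=
  ⟨_, _, Exec.realSet r i e s, le_rfl, h⟩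

/-- With the second run inside the postcondition of the first, straight-line code is verified by
symbolic execution while the time bounds add up. -/
theorem Runs.seq {P P' : Program} {s : State} {T T' : ℕ} {Q : State → Prop}
    (h : Runs P s T fun s' => Runs P' s' T' Q) : Runs (.seq P P') s (T + T') Q := by
  obtain ⟨s', t, he, ht, s'', t', he', ht', hq⟩ := h
  exact ⟨s'', _, Exec.seq he he', add_le_add ht ht', hq⟩

theorem Runs.branch {b : BExp} {P P' : Program} {s : State} {T : ℕ} {Q : State → Prop}
    (h : b.Holds s → Runs P s T Q) (h' : ¬ b.Holds s → Runs P' s T Q) :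
    Runs (.branch b P P') s (b.time + 1 + T) Q := by
  by_cases hb : b.Holds s
  · obtain ⟨s', t, he, ht, hq⟩ := h hb
    exact ⟨s', _, Exec.branch_true hb he, by omega, hq⟩
  · obtain ⟨s', t, he, ht, hq⟩ := h' hb
    exact ⟨s', _, Exec.branch_false hb he, by omega, hq⟩

/-- A loop whose body is executed exactly `N` times. -/
theorem Runs.loop {b : BExp} {P : Program} {N c : ℕ} (I : ℕ → State → Prop)
    (hstep : ∀ k < N, ∀ s, I k s → b.Holds s ∧ Runs P s c (I (k + 1)))
    (hend : ∀ s, I N s → ¬ b.Holds s) {s : State} (h : I 0 s) :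
    Runs (.loop b P) s (N * (b.time + 1 + c) + (b.time + 1)) (I N) := by
  suffices ∀ d k, k + d = N → ∀ s, I k s →
      Runs (.loop b P) s (d * (b.time + 1 + c) + (b.time + 1)) (I N) from this N 0 (by omega) s h
  intro d
  induction d with
  | zero =>
    rintro k rfl s hs
    exact ⟨s, _, Exec.loop_false (hend s hs), by omega, hs⟩
  | succ d ih =>
    intro k hk s hs
    obtain ⟨hb, s', t, he, ht, hs'⟩ := hstep k (by omega) s hs
    obtain ⟨s'', t', he', ht', hq⟩ := ih (k + 1) (by omega) s' hs'
    refine ⟨s'', _, Exec.loop_true hb he he', ?_, hq⟩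
    rw [Nat.succ_mul]
    omega

/-! ### Tournament trees

The nodes of the tree for `n` keys are numbered from `1` to `2 * n - 1`; node `q` has the children
`2 * q` and `2 * q + 1`, and node `n + l` is the leaf for the key `l`. -/

/-- Node `q` records the largest key among the leaves below it. -/
def IsWinner (n : ℕ) (κ : ℕ → ℝ) (T : ℕ → ℕ) (q : ℕ) : Prop :=
  T q < n ∧ (∃ i, (n + T q) / 2 ^ i = q) ∧ ∀ l < n, (∃ i, (n + l) / 2 ^ i = q) → κ l ≤ κ (T q)

def IsTournament (n : ℕ) (κ : ℕ → ℝ) (T : ℕ → ℕ) : Prop :=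
  ∀ q, 1 ≤ q → q < 2 * n → IsWinner n κ T q

/-- Leaf numbers are below `2 * n`, so a single halving already leaves the range of leaves. -/
theorem eq_of_leaf_below_leaf {n l q i : ℕ} (hl : l < n) (hq : n ≤ q) (h : (n + l) / 2 ^ i = q) :
    n + l = q := by
  rcases Nat.eq_zero_or_pos i with rfl | hi
  · simpa using h
  · have h1 : (n + l) / 2 ^ i ≤ (n + l) / 2 :=
      Nat.div_le_div_left (by simpa using Nat.pow_le_pow_right two_pos hi) two_pos
    omega

theorem isWinner_leaf_iff {n q : ℕ} {κ : ℕ → ℝ} {T : ℕ → ℕ} (hq : n ≤ q) (hq' : q < 2 * n) :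
    IsWinner n κ T q ↔ n + T q = q := by
  constructor
  · rintro ⟨h, ⟨i, hi⟩, -⟩
    exact eq_of_leaf_below_leaf h hq hi
  · intro h
    refine ⟨by omega, ⟨0, by simpa using h⟩, ?_⟩
    rintro l hl ⟨i, hi⟩
    have := eq_of_leaf_below_leaf hl hq hi
    rw [show T q = l by omega]

theorem exists_child {p q i : ℕ} (h : p / 2 ^ i = q) (hne : p ≠ q) :
    (∃ i, p / 2 ^ i = 2 * q) ∨ ∃ i, p / 2 ^ i = 2 * q + 1 := by
  rcases i with _ | i
  · simp at h
    exact absurd h hne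
  · rw [pow_succ, ← Nat.div_div_eq_div_mul] at h
    rcases Nat.mod_two_eq_zero_or_one (p / 2 ^ i) with h' | h'
    · exact Or.inl ⟨i, by omega⟩
    · exact Or.inr ⟨i, by omega⟩

theorem below_of_child {p q c : ℕ} (hc : c / 2 = q) (h : ∃ i, p / 2 ^ i = c) :
    ∃ i, p / 2 ^ i = q := by
  obtain ⟨i, hi⟩ := h
  exact ⟨i + 1, by rw [pow_succ, ← Nat.div_div_eq_div_mul, hi, hc]⟩

theorem IsWinner.of_child {n q c : ℕ} {κ : ℕ → ℝ} {T : ℕ → ℕ} (hq : q < n)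
    (hT : T q = T c) (hc : c / 2 = q) (h : IsWinner n κ T c)
    (hmax : ∀ c', c' / 2 = q → IsWinner n κ T c' ∧ κ (T c') ≤ κ (T c)) : IsWinner n κ T q := by
  unfold IsWinner
  rw [hT]
  refine ⟨h.1, below_of_child hc h.2.1, ?_⟩
  rintro l hl ⟨i, hi⟩
  rcases exists_child hi (by omega) with h' | h'
  · have := hmax (2 * q) (by omega)
    exact (this.1.2.2 l hl h').trans this.2
  · have := hmax (2 * q + 1) (by omega)
    exact (this.1.2.2 l hl h').trans this.2

theorem IsWinner.congr {n q : ℕ} {κ : ℕ → ℝ} {T T' : ℕ → ℕ} (h : IsWinner n κ T q)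
    (hT : T' q = T q) : IsWinner n κ T' q := by
  unfold IsWinner
  rwa [hT]

/-- Only ancestors of the leaf for `l` depend on its key, so replacing a key requires repairing a
single path. -/
theorem IsWinner.update {n q l : ℕ} {κ : ℕ → ℝ} {T : ℕ → ℕ} (h : IsWinner n κ T q)
    (hq : ∀ i, (n + l) / 2 ^ i ≠ q) (v : ℝ) : IsWinner n (Function.update κ l v) T q := by
  obtain ⟨h1, h2, h3⟩ := h
  refine ⟨h1, h2, fun l' hl' hi => ?_⟩
  have hne : ∀ l', (∃ i, (n + l') / 2 ^ i = q) → l' ≠ l := by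
    rintro l' ⟨i, hi⟩ rfl
    exact hq i hi
  rw [Function.update_of_ne (hne _ hi), Function.update_of_ne (hne _ h2)]
  exact h3 l' hl' hi

theorem div_two_pow_log {p : ℕ} (hp : p ≠ 0) : p / 2 ^ Nat.log 2 p = 1 := by
  refine Nat.div_eq_of_lt_le ?_ ?_
  · simpa using Nat.pow_log_le_self 2 hp
  · simpa [pow_succ, mul_comm] using Nat.lt_pow_succ_log_self one_lt_two p

/-- Repeated halving takes every positive number to `1`, so the root sees all leaves even when `n`
is not a power of two. -/
theorem IsTournament.le_root {n : ℕ} {κ : ℕ → ℝ} {T : ℕ → ℕ} (h : IsTournament n κ T)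
    (hn : 1 ≤ n) : T 1 < n ∧ ∀ l < n, κ l ≤ κ (T 1) := by
  obtain ⟨h1, -, h3⟩ := h 1 le_rfl (by omega)
  refine ⟨h1, fun l hl => h3 l hl ⟨Nat.log 2 (n + l), ?_⟩⟩
  exact div_two_pow_log (by omega)

/-! ### Tournament trees on the real RAM

The keys are in real array `1`, the tree is in array `1` of natural numbers, and array `3` of natural
numbers holds the current node. -/

/-- The natural number stored in cell `0` of array `r`. -/
abbrev var (r : ℕ) : NExp := .cell r (.const 0)

abbrev leftChild : NExp := .add (var 3) (var 3)

abbrev rightChild : NExp := .add (.add (var 3) (var 3)) (.const 1)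

/-- Recompute the winner at the current node. -/
def replay : Program :=
  .branch (.realLe (.cell 1 (.cell 1 rightChild)) (.cell 1 (.cell 1 leftChild)))
    (.natSet 1 (var 3) (.cell 1 leftChild))
    (.natSet 1 (var 3) (.cell 1 rightChild))

theorem replay_runs {n q : ℕ} {s : State} (hpos : s.nat 3 0 = q) (hq : 1 ≤ q) (hqn : q < n)
    (hl : IsWinner n (s.real 1) (s.nat 1) (2 * q))
    (hr : IsWinner n (s.real 1) (s.nat 1) (2 * q + 1)) :
    Runs replay s 40 fun s' => ∃ v, s' = s.setNat 1 q v ∧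
      IsWinner n (s.real 1) (Function.update (s.nat 1) q v) q := by
  have h2 : 2 * q ≠ q := by omega
  have h3 : 2 * q + 1 ≠ q := by omega
  have hl' := hl.congr (T' := Function.update (s.nat 1) q (s.nat 1 (2 * q)))
    (Function.update_of_ne h2 _ _)
  have hl'' := hl.congr (T' := Function.update (s.nat 1) q (s.nat 1 (2 * q + 1)))
    (Function.update_of_ne h2 _ _)
  have hr' := hr.congr (T' := Function.update (s.nat 1) q (s.nat 1 (2 * q)))
    (Function.update_of_ne h3 _ _)
  have hr'' := hr.congr (T' := Function.update (s.nat 1) q (s.nat 1 (2 * q + 1)))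
    (Function.update_of_ne h3 _ _)
  refine Runs.mono (Runs.branch (T := 12) ?_ ?_) (by decide) (fun _ h => h)
  · intro hb
    refine Runs.mono (Runs.natSet ?_) (by decide) (fun _ h => h)
    simp [hpos, ← two_mul] at hb ⊢
    refine ⟨_, rfl, IsWinner.of_child (c := 2 * q) hqn ?_ (by omega) hl' ?_⟩
    · simp [h2]
    · intro c' hc'
      obtain rfl | rfl : c' = 2 * q ∨ c' = 2 * q + 1 := by omega
      · exact ⟨hl', le_rfl⟩
      · exact ⟨hr', by simpa [h2, h3] using hb⟩
  · intro hb
    refine Runs.mono (Runs.natSet ?_) (by decide) (fun _ h => h)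
    simp [hpos, ← two_mul] at hb ⊢
    refine ⟨_, rfl, IsWinner.of_child (c := 2 * q + 1) hqn ?_ (by omega) hr'' ?_⟩
    · simp [h3]
    · intro c' hc'
      obtain rfl | rfl : c' = 2 * q ∨ c' = 2 * q + 1 := by omega
      · exact ⟨hl'', by simpa [h2, h3] using hb.le⟩
      · exact ⟨hr'', le_rfl⟩

/-- Recompute the winners on the way from the current node to the root. -/
def climb : Program :=
  .loop (.natLe (.const 2) (var 3)) (.seq (.natSet 3 (.const 0) (.half (var 3))) replay)

theorem climb_runs {n l : ℕ} {κ : ℕ → ℝ} {v : ℝ} {s : State} (hl : l < n)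
    (hpos : s.nat 3 0 = n + l) (htree : IsTournament n κ (s.nat 1))
    (hκ : s.real 1 = Function.update κ l v) :
    Runs climb s (60 * (Nat.log 2 n + 2)) fun s' => s'.real = s.real ∧
      (∀ r, r ≠ 1 → r ≠ 3 → s'.nat r = s.nat r) ∧ IsTournament n (s.real 1) (s'.nat 1) := by
  set N := Nat.log 2 (n + l) with hN
  have hNle : N ≤ Nat.log 2 n + 1 := by
    rw [hN, ← Nat.log_mul_base (by omega) (by omega)]
    exact Nat.log_mono_right (by omega)
  -- After `k` steps the only nodes that may be wrong are the ancestors still to be visited.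
  let I : ℕ → State → Prop := fun k s' => s'.nat 3 0 = (n + l) / 2 ^ k ∧ s'.real = s.real ∧
    (∀ r, r ≠ 1 → r ≠ 3 → s'.nat r = s.nat r) ∧
    ∀ q, 1 ≤ q → q < 2 * n → (∀ i, k < i → (n + l) / 2 ^ i ≠ q) →
      IsWinner n (s.real 1) (s'.nat 1) q
  refine Runs.mono (Runs.loop (N := N) (c := 46) I ?_ ?_ ?_) ?_ ?_
  · rintro k hk s' ⟨h1, h2, h3, h4⟩
    have hge : 2 ≤ (n + l) / 2 ^ k := by
      rw [Nat.le_div_iff_mul_le (by positivity), ← pow_succ']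
      exact (Nat.pow_le_pow_right two_pos hk).trans (Nat.pow_log_le_self 2 (by omega))
    have hhalf : (n + l) / 2 ^ k / 2 = (n + l) / 2 ^ (k + 1) := by
      rw [pow_succ, Nat.div_div_eq_div_mul]
    have hle : (n + l) / 2 ^ k ≤ n + l := Nat.div_le_self _ _
    refine ⟨by simpa [h1] using hge, Runs.mono (Runs.seq (Runs.natSet ?_))
      (show _ + 40 ≤ _ by decide) (fun _ h => h)⟩
    set q := (n + l) / 2 ^ (k + 1) with hq
    -- Ancestors yet to be visited are numbered at most `q`, so both children of `q` are already
    -- correct.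
    have hbig : ∀ c, q < c → ∀ i, k < i → (n + l) / 2 ^ i ≠ c := by
      intro c hc i hi
      have : (n + l) / 2 ^ i ≤ q := Nat.div_le_div_left (Nat.pow_le_pow_right two_pos hi)
        (by positivity)
      omega
    have hchild : ∀ c, q < c → c < 2 * n → IsWinner n (s.real 1) (s'.nat 1) c :=
      fun c hc hc' => h4 c (by omega) hc' (hbig c hc)
    refine Runs.mono (replay_runs (n := n) (q := q) ?_ (by omega) (by omega) ?_ ?_) le_rfl ?_
    · simp [h1, hhalf]
    · simpa [h2] using hchild (2 * q) (by omega) (by omega)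
    · simpa [h2] using hchild (2 * q + 1) (by omega) (by omega)
    · rintro s'' ⟨v', rfl, hw⟩
      refine ⟨by simp [h1, hhalf, hq], by simp [h2], ?_, ?_⟩
      · intro r hr hr'
        simp [hr, hr', h3 r hr hr']
      · intro q' hq1 hq2 hq3
        rcases eq_or_ne q' q with rfl | hne
        · simpa [h2] using hw
        · have := h4 q' hq1 hq2 (fun i hi => by
            rcases eq_or_ne i (k + 1) with rfl | h
            · exact hne.symm
            · exact hq3 i (by omega))
          exact this.congr (by simp [hne])
  · rintro s' ⟨h1, -⟩
    have : (n + l) / 2 ^ N = 1 := div_two_pow_log (by omega)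
    simp [h1, this]
  · refine ⟨by simpa using hpos, rfl, fun _ _ _ => rfl, fun q hq1 hq2 hq3 => ?_⟩
    have hold := htree q hq1 hq2
    rcases eq_or_ne q (n + l) with rfl | hne
    -- The changed leaf needs no repair: the winner at a leaf does not depend on the keys.
    · rw [isWinner_leaf_iff (by omega) hq2] at hold ⊢
      exact hold
    · rw [hκ]
      refine hold.update (fun i => ?_) v
      rcases Nat.eq_zero_or_pos i with rfl | hi
      · simpa using hne.symm
      · exact hq3 i hi
  · have : (BExp.natLe (.const 2) (var 3)).time = 4 := rfl
    rw [this]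
    omega
  · rintro s' ⟨-, h2, h3, h4⟩
    refine ⟨h2, h3, fun q hq1 hq2 => h4 q hq1 hq2 fun i hi => ?_⟩
    have : (n + l) / 2 ^ i = 0 := by
      refine Nat.div_eq_of_lt ?_
      exact Nat.lt_pow_of_log_lt one_lt_two hi
    omega

/-- Build the tree. -/
def build : Program :=
  .seq (.loop (.natLe (.add (var 3) (.const 1)) (var 0))
    (.seq (.natSet 1 (.add (var 0) (var 3)) (var 3))
      (.natSet 3 (.const 0) (.add (var 3) (.const 1)))))
  (.loop (.natLe (.const 2) (var 3))
    (.seq (.natSet 3 (.const 0) (.sub (var 3) (.const 1))) replay))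

theorem build_runs {n : ℕ} {s : State} (hn : 1 ≤ n) (h0 : s.nat 0 0 = n) (hpos : s.nat 3 0 = 0) :
    Runs build s (100 * n) fun s' => s'.real = s.real ∧
      (∀ r, r ≠ 1 → r ≠ 3 → s'.nat r = s.nat r) ∧ IsTournament n (s.real 1) (s'.nat 1) := by
  let I : ℕ → State → Prop := fun k s' => s'.nat 3 0 = k ∧ s'.real = s.real ∧
    (∀ r, r ≠ 1 → r ≠ 3 → s'.nat r = s.nat r) ∧ ∀ i < k, s'.nat 1 (n + i) = i
  -- Filling the leaves leaves the counter at `n`, just above the internal nodes, which are then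
  -- treated in descending order so that children precede parents.
  let J : ℕ → State → Prop := fun k s' => s'.nat 3 0 = n - k ∧ s'.real = s.real ∧
    (∀ r, r ≠ 1 → r ≠ 3 → s'.nat r = s.nat r) ∧
    ∀ q, n - k ≤ q → q < 2 * n → IsWinner n (s.real 1) (s'.nat 1) q
  refine Runs.mono (Runs.seq (T' := (n - 1) * 51 + 5)
    (Runs.mono (Runs.loop (N := n) (c := 20) I ?_ ?_ ?_) le_rfl ?_)) ?_ (fun _ h => h)
  · rintro k hk s' ⟨h1, h2, h3, h4⟩
    have h0' : s'.nat 0 0 = n := by rw [h3 0 (by decide) (by decide), h0]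
    refine ⟨by simpa [h1, h0'] using hk,
      Runs.mono (Runs.seq (Runs.natSet (Runs.natSet ?_))) (by decide) (fun _ h => h)⟩
    refine ⟨by simp [h1], by simp [h2], fun r hr hr' => by simp [hr, hr', h3], fun i hi => ?_⟩
    rcases Nat.lt_succ_iff_lt_or_eq.1 hi with hi | rfl
    · simp [h0', h1, hi.ne, h4 i hi]
    · simp [h0', h1]
  · rintro s' ⟨h1, h2, h3, h4⟩
    simp [h1, h3, h0]
  · exact ⟨hpos, rfl, fun _ _ _ => rfl, fun i hi => absurd hi (Nat.not_lt_zero i)⟩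
  · rintro s' ⟨h1, h2, h3, h4⟩
    refine Runs.mono (Runs.loop (N := n - 1) (c := 46) J ?_ ?_ ?_) le_rfl ?_
    · rintro k hk s₁ ⟨g1, g2, g3, g4⟩
      refine ⟨by simp [g1]; omega, Runs.mono (Runs.seq (Runs.natSet ?_))
        (show _ + 40 ≤ _ by decide) (fun _ h => h)⟩
      refine Runs.mono (replay_runs (n := n) (q := n - (k + 1)) ?_ (by omega) (by omega) ?_ ?_)
        le_rfl ?_
      · simp [g1]; omega
      · simpa [g2] using g4 _ (by omega) (by omega)
      · simpa [g2] using g4 _ (by omega) (by omega)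
      · rintro s₂ ⟨v, rfl, hw⟩
        refine ⟨by simp [g1]; omega, by simp [g2], fun r hr hr' => by simp [hr, hr', g3],
          fun q hq hq' => ?_⟩
        rcases eq_or_ne q (n - (k + 1)) with rfl | hne
        · simpa [g2] using hw
        · exact (g4 q (by omega) hq').congr (by simp [hne])
    · rintro s₁ ⟨g1, -⟩
      simp [g1]; omega
    · refine ⟨by simpa using h1, h2, h3, fun q hq hq' => ?_⟩
      rw [isWinner_leaf_iff (by omega) hq']
      have := h4 (q - n) (by omega)
      rw [Nat.add_sub_of_le (by omega)] at this
      omega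
    · rintro s₁ ⟨-, g2, g3, g4⟩
      exact ⟨g2, g3, fun q hq hq' => g4 q (by omega) hq'⟩
  · have : (BExp.natLe (.add (var 3) (.const 1)) (var 0)).time = 7 := rfl
    rw [this]
    omega

/-! ### Sorting by repeated extraction of the maximum

Real array `0` holds `a, b, z`, array `5` the offset `2 * z * j`, and cell `0` of array `4` of natural
numbers the counter `j`. -/

/-- The first `j` entries of `P` are the indices of the `j` largest values of `X` in descending
order, and `κ` is `X` with these values overwritten by `e`. -/
structure SelectionInv (n : ℕ) (X : ℕ → ℝ) (e : ℝ) (j : ℕ) (P : ℕ → ℕ) (κ : ℕ → ℝ) : Prop where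
  lt : ∀ i < j, P i < n
  inj : ∀ i < j, ∀ i' < j, P i = P i' → i = i'
  key : ∀ l < n, (∃ i < j, P i = l) ∧ κ l = e ∨ (∀ i < j, P i ≠ l) ∧ κ l = X l
  max : ∀ i < j, ∀ l < n, (∀ i' < i, P i' ≠ l) → X l ≤ X (P i)

/-- By pigeonhole some index is still unselected. Its key exceeds `e`, so the maximum cannot be an
overwritten key. -/
theorem SelectionInv.step {n j t : ℕ} {X κ : ℕ → ℝ} {e : ℝ} {P P' : ℕ → ℕ}
    (h : SelectionInv n X e j P κ) (hj : j < n) (he : ∀ l < n, e < X l) (ht : t < n)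
    (hmax : ∀ l < n, κ l ≤ κ t) (hP : ∀ i < j, P' i = P i) (hPj : P' j = t) :
    κ t = X t ∧ SelectionInv n X e (j + 1) P' (Function.update κ t e) := by
  obtain ⟨l, hl, hlP⟩ : ∃ l < n, ∀ i < j, P i ≠ l := by
    have hcard : ((Finset.range j).image P).card < (Finset.range n).card := by
      refine Finset.card_image_le.trans_lt ?_
      simpa using hj
    obtain ⟨l, hl, hl'⟩ := Finset.exists_mem_notMem_of_card_lt_card hcard
    refine ⟨l, Finset.mem_range.1 hl, fun i hi hil => hl' ?_⟩
    exact Finset.mem_image.2 ⟨i, Finset.mem_range.2 hi, hil⟩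
  have hκl : κ l = X l := by
    rcases h.key l hl with ⟨⟨i, hi, hil⟩, -⟩ | h'
    · exact absurd hil (hlP i hi)
    · exact h'.2
  have hκt : (∀ i < j, P i ≠ t) ∧ κ t = X t := by
    rcases h.key t ht with ⟨-, h'⟩ | h'
    · have := hmax l hl
      linarith [he l hl]
    · exact h'
  refine ⟨hκt.2, ?_, ?_, ?_, ?_⟩
  · intro i hi
    rcases Nat.lt_succ_iff_lt_or_eq.1 hi with hi | rfl
    · rw [hP i hi]
      exact h.lt i hi
    · rwa [hPj]
  · intro i hi i' hi' heq
    rcases Nat.lt_succ_iff_lt_or_eq.1 hi with hi | rfl <;>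
      rcases Nat.lt_succ_iff_lt_or_eq.1 hi' with hi' | rfl
    · rw [hP i hi, hP i' hi'] at heq
      exact h.inj i hi i' hi' heq
    · rw [hP i hi, hPj] at heq
      exact absurd heq (hκt.1 i hi)
    · rw [hP i' hi', hPj] at heq
      exact absurd heq.symm (hκt.1 i' hi')
    · rfl
  · intro l hl
    rcases eq_or_ne l t with rfl | hne
    · exact Or.inl ⟨⟨j, Nat.lt_succ_self j, hPj⟩, Function.update_self ..⟩
    · rw [Function.update_of_ne hne]
      rcases h.key l hl with ⟨⟨i, hi, hil⟩, hk⟩ | ⟨hno, hk⟩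
      · exact Or.inl ⟨⟨i, hi.trans (Nat.lt_succ_self j), by rw [hP i hi, hil]⟩, hk⟩
      · refine Or.inr ⟨fun i hi => ?_, hk⟩
        rcases Nat.lt_succ_iff_lt_or_eq.1 hi with hi | rfl
        · rw [hP i hi]
          exact hno i hi
        · rw [hPj]
          exact hne.symm
  · intro i hi l hl hno
    rcases Nat.lt_succ_iff_lt_or_eq.1 hi with hi | rfl
    · rw [hP i hi]
      exact h.max i hi l hl fun i' hi' => by
        rw [← hP i' (hi'.trans hi)]
        exact hno i' hi'
    · rw [hPj, ← hκt.2]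
      rcases h.key l hl with ⟨⟨i', hi', hil⟩, -⟩ | h'
      · exact absurd hil (by rw [← hP i' hi']; exact hno i' hi')
      · rw [← h'.2]
        exact hmax l hl

/-- The real number stored in cell `i` of array `r`. -/
abbrev rvar (r i : ℕ) : RExp := .cell r (.const i)

/-- The winner of the tournament. -/
abbrev root : NExp := .cell 1 (.const 1)

/-- Make the leaf for the key `e` the current node. -/
abbrev toLeaf (e : NExp) : Program := .natSet 3 (.const 0) (.add (var 0) e)

abbrev incr : Program := .natSet 4 (.const 0) (.add (var 4) (.const 1))

/-- The sentinel `a - z - 1` lies below every sensor position in the containing case, so an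
extracted key never wins while others remain. It is also below `b - z`, so the keys left at the end
are precisely fresh breakpoints for the regression, with a valid tree already in place. The offset
`2 * z * j` is accumulated by addition because a counter cannot be converted to a real. -/
def selectStep : Program :=
  .seq (.branch (.realLe (.sub (rvar 0 1) (rvar 0 2)) (.add (.cell 1 root) (rvar 5 0)))
      (.realSet 3 (var 4) (.add (.cell 1 root) (rvar 5 0)))
      (.realSet 3 (var 4) (.sub (rvar 0 1) (rvar 0 2))))
  (.seq (.natSet 2 (var 4) root)
  (.seq (.realSet 5 (.const 0) (.add (rvar 5 0) (.add (rvar 0 2) (rvar 0 2))))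
  (.seq (.realSet 1 root (.sub (.sub (rvar 0 0) (rvar 0 2)) (.const 1)))
  (.seq (toLeaf root)
  (.seq incr climb)))))

theorem selectStep_runs {n : ℕ} {s : State} (hn : 1 ≤ n) (h0 : s.nat 0 0 = n)
    (htree : IsTournament n (s.real 1) (s.nat 1)) :
    Runs selectStep s (60 * (Nat.log 2 n + 2) + 100) fun s' =>
      s'.nat 0 = s.nat 0 ∧ s'.nat 4 0 = s.nat 4 0 + 1 ∧
      s'.nat 2 = Function.update (s.nat 2) (s.nat 4 0) (s.nat 1 1) ∧ s'.real 0 = s.real 0 ∧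
      s'.real 1 = Function.update (s.real 1) (s.nat 1 1) (s.real 0 0 - s.real 0 2 - 1) ∧
      s'.real 3 = Function.update (s.real 3) (s.nat 4 0)
        (max (s.real 1 (s.nat 1 1) + s.real 5 0) (s.real 0 1 - s.real 0 2)) ∧
      s'.real 5 0 = s.real 5 0 + (s.real 0 2 + s.real 0 2) ∧
      IsTournament n (s'.real 1) (s'.nat 1) := by
  have hroot := (htree.le_root hn).1
  refine Runs.mono (Runs.seq (T' := 60 * (Nat.log 2 n + 2) + 50) (Runs.mono (Runs.branch (T := 20)
    (Q := fun s' => s' = s.setReal 3 (s.nat 4 0)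
      (max (s.real 1 (s.nat 1 1) + s.real 5 0) (s.real 0 1 - s.real 0 2))) ?_ ?_) le_rfl ?_)) ?_
    (fun _ h => h)
  · intro hb
    refine Runs.mono (Runs.realSet ?_) (by decide) (fun _ h => h)
    simp at hb
    simp [hb]
  · intro hb
    refine Runs.mono (Runs.realSet ?_) (by decide) (fun _ h => h)
    simp only [BExp.Holds, NExp.eval, RExp.eval, not_le] at hb
    simp only [NExp.eval, RExp.eval, max_eq_right hb.le]
  · rintro _ rfl
    refine Runs.mono (Runs.seq (Runs.natSet (Runs.seq (Runs.realSet (Runs.seq (Runs.realSet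
      (Runs.seq (Runs.natSet (Runs.seq (Runs.natSet
      (Runs.mono (climb_runs (n := n) (l := s.nat 1 1) (κ := s.real 1)
        (v := s.real 0 0 - s.real 0 2 - 1) hroot ?_ ?_ ?_) le_rfl ?_)))))))))))
      ?_ (fun _ h => h)
    · simp [h0]
    · simpa using htree
    · simp
    · rintro s' ⟨h1, h2, h3⟩
      rw [h2 0 (by decide) (by decide), h2 2 (by decide) (by decide),
        h2 4 (by decide) (by decide), h1]
      refine ⟨?_, ?_, ?_, ?_, ?_, ?_, ?_, h3⟩ <;> simp
    · simp only [NExp.time, RExp.time]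
      omega
  · simp [NExp.time, RExp.time, BExp.time]
    omega

def select : Program := .loop (.natLe (.add (var 4) (.const 1)) (var 0)) selectStep

theorem select_runs {n : ℕ} {s : State} (hn : 1 ≤ n) (h0 : s.nat 0 0 = n) (h4 : s.nat 4 0 = 0)
    (h5 : s.real 5 0 = 0) (hX : ∀ l < n, s.real 0 0 - s.real 0 2 - 1 < s.real 1 l)
    (htree : IsTournament n (s.real 1) (s.nat 1)) :
    Runs select s (n * (60 * (Nat.log 2 n + 2) + 108) + 8) fun s' =>
      s'.nat 0 0 = n ∧ s'.real 0 = s.real 0 ∧ s'.real 5 0 = 2 * s.real 0 2 * n ∧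
      SelectionInv n (s.real 1) (s.real 0 0 - s.real 0 2 - 1) n (s'.nat 2) (s'.real 1) ∧
      (∀ i < n, s'.real 3 i =
        max (s.real 1 (s'.nat 2 i) + 2 * s.real 0 2 * i) (s.real 0 1 - s.real 0 2)) ∧
      IsTournament n (s'.real 1) (s'.nat 1) := by
  let I : ℕ → State → Prop := fun j s' =>
    s'.nat 4 0 = j ∧ s'.nat 0 0 = n ∧ s'.real 0 = s.real 0 ∧ s'.real 5 0 = 2 * s.real 0 2 * j ∧
      SelectionInv n (s.real 1) (s.real 0 0 - s.real 0 2 - 1) j (s'.nat 2) (s'.real 1) ∧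
      (∀ i < j, s'.real 3 i =
        max (s.real 1 (s'.nat 2 i) + 2 * s.real 0 2 * i) (s.real 0 1 - s.real 0 2)) ∧
      IsTournament n (s'.real 1) (s'.nat 1)
  refine Runs.mono (Runs.loop (N := n) (c := 60 * (Nat.log 2 n + 2) + 100) I ?_ ?_ ?_) ?_ ?_
  · rintro j hj s' ⟨g4, g0, gr0, g5, gsel, g3, gtree⟩
    refine ⟨by simpa [g4, g0] using hj, Runs.mono (selectStep_runs hn g0 gtree) le_rfl ?_⟩
    rintro s₁ ⟨k0, k4, k2, kr0, kr1, kr3, kr5, ktree⟩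
    obtain ⟨hroot, hmax⟩ := gtree.le_root hn
    rw [g4] at k4 k2 kr3
    have hP : ∀ i < j, s₁.nat 2 i = s'.nat 2 i := fun i hi => by
      rw [k2, Function.update_of_ne hi.ne]
    have hPj : s₁.nat 2 j = s'.nat 1 1 := by rw [k2, Function.update_self]
    obtain ⟨hXt, hsel⟩ := gsel.step hj hX hroot hmax hP hPj
    refine ⟨k4, by rw [k0, g0], by rw [kr0, gr0], ?_, ?_, ?_, ktree⟩
    · rw [kr5, g5, gr0]
      push_cast
      ring
    · rwa [kr1, gr0]
    · intro i hi
      rcases Nat.lt_succ_iff_lt_or_eq.1 hi with hi | rfl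
      · rw [kr3, Function.update_of_ne hi.ne, hP i hi, g3 i hi]
      · rw [kr3, Function.update_self, hPj, g5, gr0, hXt]
  · rintro s' ⟨g4, g0, -⟩
    simp [g4, g0]
  · refine ⟨h4, h0, rfl, by simp [h5], ⟨?_, ?_, ?_, ?_⟩, ?_, htree⟩
    · simp
    · simp
    · exact fun l _ => Or.inr ⟨by simp, rfl⟩
    · simp
    · simp
  · have : (BExp.natLe (.add (var 4) (.const 1)) (var 0)).time = 7 := rfl
    rw [this]
    exact Nat.add_le_add_right (Nat.mul_le_mul_left _ (by omega)) _
  · rintro s' ⟨-, g0, gr0, g5, gsel, g3, gtree⟩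
    exact ⟨g0, gr0, g5, gsel, g3, gtree⟩

/-! ### The regression -/

/-- The two insertions of the target are two key replacements, each followed by a climb: first into
the fresh slot `j`, then over the maximum, which is recorded in real array `4` beforehand. -/
def regressStep : Program :=
  .seq (.realSet 1 (var 4) (.cell 3 (var 4)))
  (.seq (toLeaf (var 4))
  (.seq climb
  (.seq (.realSet 4 (var 4) (.cell 1 root))
  (.seq (.realSet 1 root (.cell 3 (var 4)))
  (.seq (toLeaf root)
  (.seq incr climb))))))

theorem regressStep_runs {n j : ℕ} {s : State} (hj : j < n) (h0 : s.nat 0 0 = n)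
    (h4 : s.nat 4 0 = j) (htree : IsTournament n (s.real 1) (s.nat 1)) :
    Runs regressStep s (120 * (Nat.log 2 n + 2) + 100) fun s' =>
      s'.nat 0 = s.nat 0 ∧ s'.nat 4 0 = j + 1 ∧ s'.nat 2 = s.nat 2 ∧ s'.real 0 = s.real 0 ∧
      s'.real 3 = s.real 3 ∧ s'.real 5 = s.real 5 ∧ IsTournament n (s'.real 1) (s'.nat 1) ∧
      ∃ l < n, (∀ i < n, Function.update (s.real 1) j (s.real 3 j) i ≤
          Function.update (s.real 1) j (s.real 3 j) l) ∧
        s'.real 4 = Function.update (s.real 4) j (Function.update (s.real 1) j (s.real 3 j) l) ∧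
        s'.real 1 = Function.update (Function.update (s.real 1) j (s.real 3 j)) l
          (s.real 3 j) := by
  refine Runs.mono (Runs.seq (Runs.realSet (Runs.seq (Runs.natSet (Runs.seq
    (T' := 60 * (Nat.log 2 n + 2) + 50)
    (Runs.mono (climb_runs (n := n) (l := j) (κ := s.real 1) (v := s.real 3 j) hj ?_ ?_ ?_)
      le_rfl ?_)))))) ?_ (fun _ h => h)
  · simp [h0, h4]
  · simpa using htree
  · simp [h4]
  · rintro s₁ ⟨g1, g2, g3⟩
    have k0 : s₁.nat 0 = s.nat 0 := by rw [g2 0 (by decide) (by decide)]; simp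
    have k2 : s₁.nat 2 = s.nat 2 := by rw [g2 2 (by decide) (by decide)]; simp
    have k4 : s₁.nat 4 0 = j := by rw [g2 4 (by decide) (by decide)]; simp [h4]
    have kr0 : s₁.real 0 = s.real 0 := by rw [g1]; simp
    have kr1 : s₁.real 1 = Function.update (s.real 1) j (s.real 3 j) := by rw [g1]; simp [h4]
    have kr3 : s₁.real 3 = s.real 3 := by rw [g1]; simp
    have kr4 : s₁.real 4 = s.real 4 := by rw [g1]; simp
    have kr5 : s₁.real 5 = s.real 5 := by rw [g1]; simp
    rw [← g1] at g3
    clear g1 g2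
    obtain ⟨hroot, hmax⟩ := g3.le_root (by omega)
    refine Runs.mono (Runs.seq (Runs.realSet (Runs.seq (Runs.realSet
      (Runs.seq (Runs.natSet (Runs.seq (Runs.natSet
      (Runs.mono (climb_runs (n := n) (l := s₁.nat 1 1) (κ := s₁.real 1)
        (v := s.real 3 j) hroot ?_ ?_ ?_) le_rfl ?_))))))))) ?_ (fun _ h => h)
    · simp [k0, h0]
    · simpa using g3
    · simp [kr3, k4]
    · rintro s' ⟨m1, m2, m3⟩
      rw [m2 0 (by decide) (by decide), m2 2 (by decide) (by decide),
        m2 4 (by decide) (by decide)]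
      rw [← m1] at m3
      refine ⟨by simp [k0], by simp [k4], by simp [k2], by simp [m1, kr0], by simp [m1, kr3],
        by simp [m1, kr5], m3, s₁.nat 1 1, hroot, kr1 ▸ hmax, ?_, ?_⟩
      · simp [m1, kr4, k4, kr1]
      · simp [m1, kr3, k4, kr1]
    · simp [NExp.time, RExp.time]
      omega
  · simp [NExp.time, RExp.time]
    omega

def regress : Program :=
  .seq (.natSet 4 (.const 0) (.const 0))
    (.loop (.natLe (.add (var 4) (.const 1)) (var 0)) regressStep)

theorem regress_runs {n : ℕ} {d : ℝ} {s : State} (h0 : s.nat 0 0 = n)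
    (hκ : ∀ l < n, s.real 1 l < d) (hw : ∀ j < n, d ≤ s.real 3 j)
    (htree : IsTournament n (s.real 1) (s.nat 1)) :
    Runs regress s (n * (120 * (Nat.log 2 n + 2) + 108) + 11) fun s' =>
      s'.nat 4 0 = n ∧ s'.nat 2 = s.nat 2 ∧ s'.real 0 = s.real 0 ∧ s'.real 5 = s.real 5 ∧
      ∃ κ, RegressionInv n d (s.real 3) (s'.real 4) n κ := by
  let I : ℕ → State → Prop := fun j s' =>
    s'.nat 4 0 = j ∧ s'.nat 0 0 = n ∧ s'.nat 2 = s.nat 2 ∧ s'.real 0 = s.real 0 ∧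
      s'.real 3 = s.real 3 ∧ s'.real 5 = s.real 5 ∧ IsTournament n (s'.real 1) (s'.nat 1) ∧
      RegressionInv n d (s.real 3) (s'.real 4) j (s'.real 1)
  refine Runs.mono (Runs.seq (Runs.natSet (Runs.mono (Runs.loop (N := n)
    (c := 120 * (Nat.log 2 n + 2) + 100) I ?_ ?_ ?_) le_rfl ?_))) ?_ (fun _ h => h)
  · rintro j hj s' ⟨g4, g0, g2, gr0, gr3, gr5, gtree, greg⟩
    refine ⟨by simpa [g4, g0] using hj, Runs.mono (regressStep_runs hj g0 g4 gtree) le_rfl ?_⟩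
    rintro s₁ ⟨k0, k4, k2, kr0, kr3, kr5, ktree, l, hl, hmax, kr4, kr1⟩
    rw [gr3] at hmax kr4 kr1
    refine ⟨k4, by rw [k0, g0], by rw [k2, g2], by rw [kr0, gr0], by rw [kr3, gr3],
      by rw [kr5, gr5], ktree, ?_⟩
    rw [kr1]
    refine greg.step hj hl (hw j hj) hmax (fun i hi => ?_) ?_
    · rw [kr4, Function.update_of_ne hi.ne]
    · rw [kr4, Function.update_self]
  · rintro s' ⟨g4, g0, -⟩
    simp [g4, g0]
  · refine ⟨by simp, by simp [h0], by simp, by simp, by simp, by simp, by simpa using htree, ?_⟩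
    exact RegressionInv.init (by simpa using hκ)
  · rintro s' ⟨g4, -, g2, gr0, -, gr5, -, greg⟩
    exact ⟨g4, g2, gr0, gr5, _, greg⟩
  · have : (BExp.natLe (.add (var 4) (.const 1)) (var 0)).time = 7 := rfl
    rw [this]
    rw [show 7 + 1 + (120 * (Nat.log 2 n + 2) + 100) = 120 * (Nat.log 2 n + 2) + 108 by omega]
    simp only [NExp.time]
    omega

/-! ### Computing the new positions -/

/-- Fixing the backward recursion as a sequence in advance lets `place_runs` compare the machine
with a given `u`. The induction peels off the top index, replacing the boundary value `c` by `min (m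
n) c`. -/
theorem exists_running_min (m : ℕ → ℝ) (n : ℕ) (c : ℝ) :
    ∃ u : ℕ → ℝ, u n = c ∧ ∀ i < n, u i = min (m i) (u (i + 1)) := by
  induction n generalizing c with
  | zero => exact ⟨fun _ => c, rfl, fun i hi => absurd hi (Nat.not_lt_zero i)⟩
  | succ n ih =>
    obtain ⟨u, hun, hu⟩ := ih (min (m n) c)
    refine ⟨Function.update u (n + 1) c, Function.update_self .., fun i hi => ?_⟩
    rw [Function.update_of_ne hi.ne]
    rcases Nat.lt_succ_iff_lt_or_eq.1 hi with hi | rfl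
    · rw [Function.update_of_ne (by omega), hu i hi]
    · rw [Function.update_self, hun]

/-- Cell `0` of real array `6` carries the running minimum. The offset left by the selection is
undone step by step, and natural-number array `2` sends each result back to the original index of
its sensor. -/
def placeStep : Program :=
  .seq (.natSet 4 (.const 0) (.sub (var 4) (.const 1)))
  (.seq (.realSet 5 (.const 0) (.sub (rvar 5 0) (.add (rvar 0 2) (rvar 0 2))))
  (.seq (.branch (.realLe (.cell 4 (var 4)) (rvar 6 0))
      (.realSet 6 (.const 0) (.cell 4 (var 4))) .skip)
  (.realSet 2 (.cell 2 (var 4)) (.sub (rvar 6 0) (rvar 5 0)))))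

theorem placeStep_runs (s : State) :
    Runs placeStep s 60 fun s' => s'.nat 4 0 = s.nat 4 0 - 1 ∧ s'.nat 2 = s.nat 2 ∧
      s'.real 0 = s.real 0 ∧ s'.real 4 = s.real 4 ∧
      s'.real 5 0 = s.real 5 0 - (s.real 0 2 + s.real 0 2) ∧
      s'.real 6 0 = min (s.real 4 (s.nat 4 0 - 1)) (s.real 6 0) ∧
      s'.real 2 = Function.update (s.real 2) (s.nat 2 (s.nat 4 0 - 1))
        (s'.real 6 0 - s'.real 5 0) := by
  refine Runs.mono (Runs.seq (Runs.natSet (Runs.seq (Runs.realSet (Runs.seq (T' := 12)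
    (Runs.branch (T := 10) ?_ ?_)))))) ?_ (fun _ h => h)
  · intro hb
    refine Runs.mono (Runs.realSet (Runs.mono (Runs.realSet ?_) (by decide) (fun _ h => h)))
      (by decide) (fun _ h => h)
    simp at hb
    simp [hb]
  · intro hb
    refine Runs.mono (Runs.skip (Runs.mono (Runs.realSet ?_) (by decide) (fun _ h => h)))
      (by decide) (fun _ h => h)
    simp at hb
    simp [min_eq_right hb.le]
  · decide

def place : Program :=
  .seq (.realSet 6 (.const 0) (.add (.sub (rvar 0 0) (rvar 0 2)) (rvar 5 0)))
    (.loop (.natLe (.const 1) (var 4)) placeStep)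

theorem place_runs {n : ℕ} {s : State} {u : ℕ → ℝ} (h4 : s.nat 4 0 = n)
    (h5 : s.real 5 0 = 2 * s.real 0 2 * n)
    (hinj : ∀ i < n, ∀ i' < n, s.nat 2 i = s.nat 2 i' → i = i')
    (hun : u n = s.real 0 0 - s.real 0 2 + 2 * s.real 0 2 * n)
    (hu : ∀ i < n, u i = min (s.real 4 i) (u (i + 1))) :
    Runs place s (n * 65 + 20) fun s' =>
      ∀ i < n, s'.real 2 (s.nat 2 i) = u i - 2 * s.real 0 2 * i := by
  let I : ℕ → State → Prop := fun k s' => s'.nat 4 0 = n - k ∧ s'.nat 2 = s.nat 2 ∧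
    s'.real 0 = s.real 0 ∧ s'.real 4 = s.real 4 ∧
    s'.real 5 0 = 2 * s.real 0 2 * (n - k : ℕ) ∧ s'.real 6 0 = u (n - k) ∧
    ∀ i, n - k ≤ i → i < n → s'.real 2 (s.nat 2 i) = u i - 2 * s.real 0 2 * i
  refine Runs.mono (Runs.seq (Runs.realSet (Runs.mono (Runs.loop (N := n)
    (c := 60) I ?_ ?_ ?_) le_rfl ?_))) ?_ (fun _ h => h)
  · rintro k hk s' ⟨g4, g2, gr0, gr4, gr5, gr6, gout⟩
    refine ⟨by simp [g4]; omega, Runs.mono (placeStep_runs s') le_rfl ?_⟩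
    rintro s₁ ⟨k4, k2, kr0, kr4, kr5, kr6, kr2⟩
    have hsub : n - k - 1 = n - (k + 1) := by omega
    have hsucc : n - (k + 1) + 1 = n - k := by omega
    rw [g4, hsub] at k4 kr6 kr2
    have kr5' : s₁.real 5 0 = 2 * s.real 0 2 * (n - (k + 1) : ℕ) := by
      rw [kr5, gr5, gr0, ← hsucc]
      push_cast
      ring
    have kr6' : s₁.real 6 0 = u (n - (k + 1)) := by
      rw [kr6, gr4, gr6, hu (n - (k + 1)) (by omega), hsucc]
    refine ⟨k4, by rw [k2, g2], by rw [kr0, gr0], by rw [kr4, gr4], kr5', kr6', ?_⟩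
    intro i hi hin
    rw [kr2, g2]
    rcases eq_or_ne i (n - (k + 1)) with rfl | hne
    · rw [Function.update_self, kr5', kr6']
    -- Injectivity of the selected indices keeps this write from destroying earlier output.
    · rw [Function.update_of_ne fun h => hne (hinj i hin _ (by omega) h)]
      exact gout i (by omega) hin
  · rintro s' ⟨g4, -⟩
    simp [g4]
  · refine ⟨by simp [h4], by simp, by simp, by simp, by simp [h5], by simp [h5, hun], ?_⟩
    intro i hi hi'
    omega
  · rintro s' ⟨-, -, -, -, -, -, gout⟩
    exact fun i hi => gout i (by omega) hi
  · have : (BExp.natLe (.const 1) (var 4)).time = 4 := rfl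
    rw [this]
    simp [NExp.time, RExp.time]
    omega

/-! ### The algorithm -/

theorem SelectionInv.exists_perm {n : ℕ} {X κ : ℕ → ℝ} {e : ℝ} {P : ℕ → ℕ}
    (h : SelectionInv n X e n P κ) :
    ∃ σ : Equiv.Perm (Fin n), (∀ j : Fin n, (σ j : ℕ) = P j) ∧
      (∀ i j : Fin n, i ≤ j → X (σ j) ≤ X (σ i)) ∧ ∀ l < n, κ l = e := by
  let f : Fin n → Fin n := fun j => ⟨P j, h.lt j j.2⟩
  have hf : Function.Injective f := fun i j hij =>
    Fin.ext (h.inj i i.2 j j.2 (Fin.mk.inj_iff.1 hij))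
  have hbij : Function.Bijective f := Finite.injective_iff_bijective.1 hf
  refine ⟨Equiv.ofBijective f hbij, fun j => rfl, fun i j hij => ?_, fun l hl => ?_⟩
  · refine h.max i i.2 (P j) (h.lt j j.2) fun i' hi' heq => ?_
    have h1 := h.inj i' (hi'.trans i.2) j j.2 heq
    have h2 : (i : ℕ) ≤ j := hij
    omega
  · obtain ⟨j, hj⟩ := hbij.2 ⟨l, hl⟩
    rcases h.key l hl with h' | h'
    · exact h'.2
    · exact absurd (Fin.mk.inj_iff.1 hj) (h'.1 j j.2)

def solve : Program := .seq build (.seq select (.seq regress place))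

theorem solve_runs {n : ℕ} {a b z : ℝ} {x : Fin n → ℝ} (hn : 1 ≤ n) (hz : 0 ≤ z) (hab : a ≤ b)
    (hlen : b - a ≤ 2 * z * n) (hx : Containing a b z x) :
    Runs solve (inputState a b z x) (390 * (n * (Nat.log 2 n + 2)))
      fun s => IsOptimal a b z x (s.output n) := by
  have hX : ∀ i : Fin n, (inputState a b z x).real 1 i = x i := fun i => by simp [inputState]
  have ha : (inputState a b z x).real 0 0 = a := by simp [inputState]
  have hb : (inputState a b z x).real 0 1 = b := by simp [inputState]
  have hz' : (inputState a b z x).real 0 2 = z := by simp [inputState]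
  have h0 : (inputState a b z x).nat 0 0 = n := by simp [inputState]
  have h3 : (inputState a b z x).nat 3 0 = 0 := by simp [inputState]
  have h4 : (inputState a b z x).nat 4 0 = 0 := by simp [inputState]
  have h5 : (inputState a b z x).real 5 0 = 0 := by simp [inputState]
  generalize inputState a b z x = s at *
  refine Runs.mono (Runs.seq (T' := n * (60 * (Nat.log 2 n + 2) + 108) + 8 +
    (n * (120 * (Nat.log 2 n + 2) + 108) + 11 + (n * 65 + 20)))
    (Runs.mono (build_runs hn h0 h3) le_rfl ?_)) ?_ (fun _ h => h)
  · rintro s₁ ⟨g1, g2, gtree⟩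
    rw [← g1] at gtree
    refine Runs.seq (Runs.mono (select_runs hn ?_ ?_ ?_ ?_ gtree) le_rfl ?_)
    · rw [g2 0 (by decide) (by decide), h0]
    · rw [g2 4 (by decide) (by decide), h4]
    · rw [g1, h5]
    · intro l hl
      rw [g1, ha, hz', hX ⟨l, hl⟩]
      obtain ⟨p, hp, hp'⟩ := hx ⟨l, hl⟩
      linarith [hp.2, hp'.1]
    rw [g1, ha, hb, hz']
    rintro s₂ ⟨k0, kr0, k5, ksel, k3, ktree⟩
    obtain ⟨σ, hσ, hanti, hκ⟩ := ksel.exists_perm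
    refine Runs.seq (Runs.mono (regress_runs (d := b - z) k0 ?_ ?_ ktree) le_rfl ?_)
    · intro l hl
      rw [hκ l hl]
      linarith
    · intro j hj
      rw [k3 j hj]
      exact le_max_right _ _
    rintro s₃ ⟨l4, l2, lr0, l5, κ, lreg⟩
    obtain ⟨u, hun, hu⟩ := exists_running_min (s₃.real 4) n (a - z + 2 * z * n)
    refine Runs.mono (place_runs (u := u) l4 ?_ ?_ ?_ hu) le_rfl ?_
    · rw [l5, k5, lr0, kr0, hz']
    · rw [l2]
      exact ksel.inj
    · rw [hun, lr0, kr0, ha, hz']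
    rw [lr0, kr0, hz', l2]
    intro s₄ hout
    refine isOptimal_of_regression hn hz hab hlen hx σ ?_ ?_ lreg hun hu ?_
    · intro i j hij
      simpa [hX] using hanti i j hij
    · intro j
      rw [k3 j j.2, ← hσ j, hX]
    · intro j
      have := hout j j.2
      rwa [← hσ j] at this
  -- With `L = Nat.log 2 n + 2 ≥ 2`, the total is `180 * n * L + 381 * n + 39`. Since `n ≤ n * L /
  -- 2` and `1 ≤ n * L / 2`, this is at most `390 * n * L`.
  · have : n * (60 * (Nat.log 2 n + 2) + 108) + n * (120 * (Nat.log 2 n + 2) + 108) =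
      180 * (n * (Nat.log 2 n + 2)) + 216 * n := by ring
    have : n * 2 ≤ n * (Nat.log 2 n + 2) := Nat.mul_le_mul_left _ (by omega)
    omega

/-- Since `Real.log 2 ≥ 1 / 2`, the binary logarithm is at most `2 * Real.log (n + 1)`, and the
summand `2` is at most `4 * Real.log 2 ≤ 4 * Real.log (n + 1)`. -/
theorem log_two_add_two_le {n : ℕ} (hn : 1 ≤ n) :
    ((Nat.log 2 n + 2 : ℕ) : ℝ) ≤ 6 * Real.log (n + 1) := by
  have hn' : (1 : ℝ) ≤ n := by exact_mod_cast hn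
  have h2 : (1 : ℝ) / 2 ≤ Real.log 2 := by linarith [Real.log_two_gt_d9]
  have h1 : Real.log 2 ≤ Real.log (n + 1) := Real.log_le_log (by norm_num) (by linarith)
  have h3 : (Nat.log 2 n : ℝ) * Real.log 2 ≤ Real.log (n + 1) := by
    rw [← Real.log_pow]
    refine Real.log_le_log (by positivity) ?_
    have : ((2 ^ Nat.log 2 n : ℕ) : ℝ) ≤ n := by exact_mod_cast Nat.pow_log_le_self 2 (by omega)
    push_cast at this
    linarith
  have h4 : (Nat.log 2 n : ℝ) * (1 / 2) ≤ Nat.log 2 n * Real.log 2 :=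
    mul_le_mul_of_nonneg_left h2 (Nat.cast_nonneg _)
  push_cast
  linarith

end MSBC

theorem mainTheorem3 :
    ∃ (P : MSBC.Program) (C : ℝ),
      ∀ (n : ℕ) (a b z : ℝ) (x : Fin n → ℝ),
        1 ≤ n → 0 ≤ z → a ≤ b → b - a ≤ 2 * z * n → MSBC.Containing a b z x →
          ∃ (s : MSBC.State) (t : ℕ),
            MSBC.Exec P (MSBC.inputState a b z x) s t ∧
            (t : ℝ) ≤ C * (n * Real.log (n + 1)) ∧
            MSBC.IsOptimal a b z x (s.output n) := by
  -- Here `2340 = 390 * 6`, the product of the constants in `solve_runs` and `log_two_add_two_le`.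
  refine ⟨MSBC.solve, 2340, fun n a b z x hn hz hab hlen hx => ?_⟩
  obtain ⟨s, t, he, ht, hopt⟩ := MSBC.solve_runs hn hz hab hlen hx
  refine ⟨s, t, he, ?_, hopt⟩
  have h1 : (t : ℝ) ≤ 390 * (n * ((Nat.log 2 n + 2 : ℕ) : ℝ)) := by exact_mod_cast ht
  have h2 : (n : ℝ) * ((Nat.log 2 n + 2 : ℕ) : ℝ) ≤ n * (6 * Real.log (n + 1)) :=
    mul_le_mul_of_nonneg_left (MSBC.log_two_add_two_le hn) (Nat.cast_nonneg _)
  linarith
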